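/- Let $K$ be a field of characteristic zero with commuting derivations $\Delta=\{\delta_1,\dots,\delta_m\}$ and let $F\subseteq K$ be a $\Delta$-subfield (for instance, $K$ a sufficiently saturated differentially closed field and $F$ small). A $\Delta$-variety over $F$ in $K^n$ is the set of common zeros in $K^n$ of a set of $\Delta$-polynomials over $F$ in $n$ variables. It is $F$-irreducible if it is nonempty and, whenever it is contained in the union of two $\Delta$-varieties over $F$, it is contained in one of them. A point $c\in X$ is generic in $X$ (over $F$) if $X$ is the smallest $\Delta$-variety over $F$ containing $c$. For $c=(c_1,\dots,c_n)\in K^n$ and $t\ge 0$ let $$\nabla_t c=\big(\delta_1^{e_1}\cdots\delta_m^{e_m}c_i:\ 1\le i\le n,\ e_1+\cdots+e_m\le t\big).$$ For $F$-irreducible $\Delta$-varieties $Y\subseteq X$ over $F$, say that $Y$ has codimension one in $X$ if $X$ and $Y$ have generic points and, for generic $x\in X$ and $y\in Y$, $\operatorname{trdeg}_F F(\nabla_t y)=\operatorname{trdeg}_F F(\nabla_t x)-1$ for all sufficiently large $t$ (this does not depend on the choice of $x$ and $y$). Let $X\subseteq K^n$ be an $F$-irreducible $\Delta$-variety over $F$.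 Then there is an integer $\ell\ge 0$ such that for every $F$-irreducible $\Delta$-subvariety $Y\subseteq X$ over $F$ of codimension one in $X$, and all generic points $x\in X$ and $y\in Y$, $$\operatorname{trdeg}_F F(\nabla_t y)=\operatorname{trdeg}_F F(\nabla_t x)-1\qquad\text{for all } t\ge \ell .$$ -/

import Mathlib

namespace DeltaGeometry

variable {K : Type*} [Field K] {m n : ℕ}

/-- The derivative operator `δ₁^{e₁} ⋯ δₘ^{eₘ}` attached to a multi-index `e`. -/
noncomputable def derivOp (δ : Fin m → Derivation ℤ K K) (e : Fin m → ℕ) : K →ₗ[ℤ] K :=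
  (List.ofFn fun k => ((δ k : K →ₗ[ℤ] K) : Module.End ℤ K) ^ e k).prod

/-- The ring `F{u₁, …, uₙ}` of `Δ`-polynomials over `F`, i.e. the polynomial ring in the algebraic
indeterminates `θ uᵢ`; the pair `(i, e)` stands for `δ₁^{e₁} ⋯ δₘ^{eₘ} uᵢ`. -/
abbrev DeltaPoly (F : Subfield K) (m n : ℕ) : Type _ :=
  MvPolynomial (Fin n × (Fin m → ℕ)) F

/-- The value `f(c)` of a `Δ`-polynomial `f` at a point `c` of `Kⁿ`. -/
noncomputable def evalAt (δ : Fin m → Derivation ℤ K K) (F : Subfield K) (c : Fin n → K)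
    (f : DeltaPoly F m n) : K :=
  MvPolynomial.aeval (fun p : Fin n × (Fin m → ℕ) => derivOp δ p.2 (c p.1)) f

/-- The common zeros in `Kⁿ` of a set of `Δ`-polynomials over `F`. -/
def zeroSet (δ : Fin m → Derivation ℤ K K) (F : Subfield K) (S : Set (DeltaPoly F m n)) :
    Set (Fin n → K) :=
  {c | ∀ f ∈ S, evalAt δ F c f = 0}

/-- `X ⊆ Kⁿ` is a `Δ`-variety over `F` (a Kolchin closed set over `F`). -/
def IsDeltaVariety (δ : Fin m → Derivation ℤ K K) (F : Subfield K) (X : Set (Fin n → K)) : Prop :=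
  ∃ S : Set (DeltaPoly F m n), X = zeroSet δ F S

/-- `X` is an `F`-irreducible `Δ`-variety over `F`: it is nonempty and is not covered by two
`Δ`-varieties over `F` neither of which contains it. -/
structure IsIrredDeltaVariety (δ : Fin m → Derivation ℤ K K) (F : Subfield K)
    (X : Set (Fin n → K)) : Prop where
  isDeltaVariety : IsDeltaVariety δ F X
  nonempty : X.Nonempty
  irreducible : ∀ A B : Set (Fin n → K), IsDeltaVariety δ F A → IsDeltaVariety δ F B →
    X ⊆ A ∪ B → X ⊆ A ∨ X ⊆ B

/-- The Kolchin locus of `c` over `F`: the smallest `Δ`-variety over `F` containing `c`. -/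
def kolchinLocus (δ : Fin m → Derivation ℤ K K) (F : Subfield K) (c : Fin n → K) :
    Set (Fin n → K) :=
  ⋂₀ {Z | IsDeltaVariety δ F Z ∧ c ∈ Z}

/-- `c` is a generic point of `X` over `F`. -/
def IsGenericPoint (δ : Fin m → Derivation ℤ K K) (F : Subfield K) (X : Set (Fin n → K))
    (c : Fin n → K) : Prop :=
  c ∈ X ∧ X = kolchinLocus δ F c

/-- The field `F(∇ₜ c)` generated over `F` by all `θ cᵢ` with `θ` of order at most `t`. -/
noncomputable def prolongationField (δ : Fin m → Derivation ℤ K K) (F : Subfield K) (t : ℕ)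
    (c : Fin n → K) : IntermediateField F K :=
  IntermediateField.adjoin F
    {a | ∃ (i : Fin n) (e : Fin m → ℕ), ∑ k, e k ≤ t ∧ a = derivOp δ e (c i)}

/-- The transcendence degree of `F(∇ₜ c)` over `F`. -/
noncomputable def prolongationTrdeg (δ : Fin m → Derivation ℤ K K) (F : Subfield K) (t : ℕ)
    (c : Fin n → K) : Cardinal :=
  Algebra.trdeg F (prolongationField δ F t c)

/-- `Y` has codimension one in `X` (both `F`-irreducible): for generic points `x` of `X` and `y` of
`Y`, `trdeg F(∇ₜ y) = trdeg F(∇ₜ x) - 1` for all sufficiently large `t`. The equation is written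
additively to avoid a truncated subtraction. -/
def IsCodimOne (δ : Fin m → Derivation ℤ K K) (F : Subfield K) (X Y : Set (Fin n → K)) : Prop :=
  Y ⊆ X ∧ ∃ x y, IsGenericPoint δ F X x ∧ IsGenericPoint δ F Y y ∧
    ∃ t₀ : ℕ, ∀ t ≥ t₀, prolongationTrdeg δ F t y + 1 = prolongationTrdeg δ F t x

end DeltaGeometry

/-! Rank the derivatives of the coordinates by an orderly ranking, and call a derivative of `c`
parametric if it is transcendental over `F` and the derivatives of lower rank. Parametric
derivatives of order at most `t` form a transcendence basis of `F(∇ₜ c)`, so the transcendence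
degree is a count (`prolongationTrdeg_eq_ncard`). Differentiating an algebraic relation shows that
non-parametric derivatives are stable under every `δ k` (`shift_notMem_parametricSet`), so `c`
yields a family of `n` lower sets in `ℕ^m`.

Such families are well-quasi-ordered by inclusion (`wellQuasiOrderedLE_lowerSet`). Two nested
families with eventually equal counts coincide, so those whose count is eventually that of `X` minus
one form an antichain, hence a finite set, and one threshold serves them all
(`exists_uniform_bound`). -/

namespace DeltaGeometry

/-! ### Lower sets of multi-indices and their well-quasi-order -/

section LowerSets

variable {m n : ℕ}

/-- The box of multi-indices bounded by `w`, whose sides may be infinite. -/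
def box (w : Fin m → ℕ∞) : Set (Fin m → ℕ) :=
  {e | ∀ k, (e k : ℕ∞) ≤ w k}

theorem box_mono {v w : Fin m → ℕ∞} (h : v ≤ w) : box v ⊆ box w :=
  fun _ he k => (he k).trans (h k)

/-- A point has finitely many finite coordinates, so each is bounded by some member of the chain and
directedness gives a common one. This supplies the chain bounds for Zorn's lemma. -/
theorem exists_mem_of_isChain_of_mem_box_sSup {c : Set (Fin m → ℕ∞)} (hc : IsChain (· ≤ ·) c)
    (hne : c.Nonempty) {e : Fin m → ℕ} (he : e ∈ box (sSup c)) : ∃ w ∈ c, e ∈ box w := by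
  have hside : ∀ k, ∃ w ∈ c, (e k : ℕ∞) ≤ w k := by
    intro k
    rcases Nat.eq_zero_or_pos (e k) with h0 | hpos
    · obtain ⟨w, hw⟩ := hne
      exact ⟨w, hw, by simp [h0]⟩
    -- Passing to `e k - 1` makes the inequality strict, so that some member of `c` exceeds it.
    · have hlt : ((e k - 1 : ℕ) : ℕ∞) < sSup c k :=
        lt_of_lt_of_le (by exact_mod_cast Nat.sub_lt hpos one_pos) (he k)
      rw [sSup_apply, lt_iSup_iff] at hlt
      obtain ⟨⟨w, hw⟩, hlt⟩ := hlt
      refine ⟨w, hw, ?_⟩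
      have := Order.add_one_le_of_lt hlt
      have h1 : ((e k - 1 : ℕ) : ℕ∞) + 1 = (e k : ℕ∞) := by
        exact_mod_cast Nat.sub_add_cancel hpos
      rwa [h1] at this
  obtain ⟨w, hw, hle⟩ := DirectedOn.exists_mem_subset_of_finset_subset_biUnion hne
    (f := fun w => {k | (e k : ℕ∞) ≤ w k}) (s := Finset.univ)
    (hc.directedOn.mono' fun v _ w _ hvw k hk => le_trans hk (hvw k))
    (fun k _ => by simpa using hside k)
  exact ⟨w, hw, fun k => hle (Finset.mem_coe.2 (Finset.mem_univ k))⟩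

theorem exists_maximal_box {D : LowerSet (Fin m → ℕ)} {e : Fin m → ℕ} (he : e ∈ D) :
    ∃ w, Maximal (fun w => box w ⊆ (D : Set (Fin m → ℕ))) w ∧ e ∈ box w := by
  have hbox : box (fun k => (e k : ℕ∞)) ⊆ (D : Set (Fin m → ℕ)) := fun e' he' =>
    D.lower (fun k => Nat.cast_le.1 (he' k)) he
  obtain ⟨w, hle, hw⟩ := zorn_le_nonempty₀ {w | box w ⊆ (D : Set (Fin m → ℕ))}
    (fun c hcV hc y hy => ⟨sSup c, fun e' he' => by
      obtain ⟨w, hw, hew⟩ := exists_mem_of_isChain_of_mem_box_sSup hc ⟨y, hy⟩ he'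
      exact hcV hw hew, fun z hz => le_sSup hz⟩) _ hbox
  exact ⟨w, hw, fun k => hle k⟩

/-- Every set of multi-indices closed downwards is a finite union of boxes. -/
theorem exists_list_box (D : LowerSet (Fin m → ℕ)) :
    ∃ l : List (Fin m → ℕ∞), ∀ e, e ∈ D ↔ ∃ w ∈ l, e ∈ box w := by
  -- Maximal boxes form an antichain in the well-quasi-order `ℕ∞^m`.
  have hfin : {w | Maximal (fun w => box w ⊆ (D : Set (Fin m → ℕ))) w}.Finite :=
    WellQuasiOrderedLE.finite_of_isAntichain (setOfPred_maximal_antichain _)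
  refine ⟨hfin.toFinset.toList, fun e => ⟨fun he => ?_, ?_⟩⟩
  · obtain ⟨w, hw, hew⟩ := exists_maximal_box he
    exact ⟨w, by simpa using hw, hew⟩
  · rintro ⟨w, hw, hew⟩
    have hw : Maximal (fun w => box w ⊆ (D : Set (Fin m → ℕ))) w := by simpa using hw
    exact hw.prop hew

/-- The sets of multi-indices closed downwards are well-quasi-ordered by inclusion. -/
instance wellQuasiOrderedLE_lowerSet : WellQuasiOrderedLE (LowerSet (Fin m → ℕ)) := by
  refine ⟨fun D => ?_⟩
  choose l hl using fun i => exists_list_box (D i)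
  -- Higman's lemma: some list of boxes embeds termwise into a later one, which gives inclusion of
  -- the unions.
  obtain ⟨i, j, hij, h⟩ := (Set.PartiallyWellOrderedOn.partiallyWellOrderedOn_sublistForall₂
    (s := Set.univ) (· ≤ ·) (Set.partiallyWellOrderedOn_of_wellQuasiOrdered
      (wellQuasiOrdered_le (α := Fin m → ℕ∞)) _)) fun i => ⟨l i, by simp⟩
  refine ⟨i, j, hij, fun e he => ?_⟩
  obtain ⟨w, hw, hew⟩ := (hl i e).1 he
  obtain ⟨l', hl', hsub⟩ := List.sublistForall₂_iff.1 h
  obtain ⟨v, hv, hwv⟩ : ∃ v ∈ l', w ≤ v := by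
    clear hsub h
    change List.Forall₂ (· ≤ ·) (l i) l' at hl'
    generalize l i = l₀ at hl' hw
    induction hl' with
    | nil => simp at hw
    | cons hab _ ih =>
      rcases List.mem_cons.1 hw with rfl | hw
      · exact ⟨_, by simp, hab⟩
      · obtain ⟨v, hv, hle⟩ := ih hw
        exact ⟨v, by simp [hv], hle⟩
  exact (hl j e).2 ⟨v, hsub.subset hv, box_mono hwv hew⟩

/-- The indices of order at most `t`. -/
def indicesUpTo (m n t : ℕ) : Set (Fin n × (Fin m → ℕ)) :=
  {p | ∑ k, p.2 k ≤ t}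

theorem finite_indicesUpTo (m n t : ℕ) : (indicesUpTo m n t).Finite := by
  refine ((Set.finite_univ (α := Fin n)).prod (Set.finite_Iic (fun _ : Fin m => t))).subset ?_
  rintro ⟨i, e⟩ he
  exact ⟨trivial, fun k => (Finset.single_le_sum (fun _ _ => Nat.zero_le _)
    (Finset.mem_univ k)).trans he⟩

/-- The set of pairs `(i, e)` with `e ∈ D i`. -/
def pairs (D : Fin n → LowerSet (Fin m → ℕ)) : Set (Fin n × (Fin m → ℕ)) :=
  {p | p.2 ∈ D p.1}

/-- The families of sets of multi-indices closed downwards with a prescribed Hilbert function in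
large degrees form a finite set. -/
theorem finite_setOf_eventually_ncard (g : ℕ → ℕ) :
    {D : Fin n → LowerSet (Fin m → ℕ) |
      ∃ t₀, ∀ t ≥ t₀, (pairs D ∩ indicesUpTo m n t).ncard + 1 = g t}.Finite := by
  refine IsAntichain.finite_of_wellQuasiOrdered (r := (· ≤ ·)) ?_
    (WellQuasiOrdered.pi fun _ => wellQuasiOrdered_le)
  rintro D ⟨s, hs⟩ D' ⟨s', hs'⟩ hne hle
  refine hne (le_antisymm hle fun i e he => ?_)
  by_contra hnot
  -- Large enough for both counts to be in force and for `(i, e)` to be counted.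
  set t := max (∑ k, e k) (max s s') with ht
  have hcard := (hs t (by simp [ht])).trans (hs' t (by simp [ht])).symm
  have hlt : (pairs D ∩ indicesUpTo m n t).ncard < (pairs D' ∩ indicesUpTo m n t).ncard := by
    refine Set.ncard_lt_ncard ⟨fun p hp => ⟨hle _ hp.1, hp.2⟩, fun hsub => ?_⟩
      ((finite_indicesUpTo m n t).inter_of_right _)
    have hmem : (i, e) ∈ pairs D' ∩ indicesUpTo m n t := ⟨he, le_max_left (∑ k, e k) _⟩
    exact hnot (hsub hmem).1
  omega

theorem exists_uniform_bound (g : ℕ → ℕ) :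
    ∃ ℓ, ∀ D : Fin n → LowerSet (Fin m → ℕ),
      (∃ t₀, ∀ t ≥ t₀, (pairs D ∩ indicesUpTo m n t).ncard + 1 = g t) →
      ∀ t ≥ ℓ, (pairs D ∩ indicesUpTo m n t).ncard + 1 = g t := by
  have hfin := finite_setOf_eventually_ncard (m := m) (n := n) g
  have hev : ∀ᶠ ℓ in Filter.atTop, ∀ D ∈ {D : Fin n → LowerSet (Fin m → ℕ) |
      ∃ t₀, ∀ t ≥ t₀, (pairs D ∩ indicesUpTo m n t).ncard + 1 = g t},
      ∀ t ≥ ℓ, (pairs D ∩ indicesUpTo m n t).ncard + 1 = g t := by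
    rw [Filter.eventually_all_finite hfin]
    rintro D ⟨t₀, h⟩
    filter_upwards [Filter.eventually_ge_atTop t₀] with ℓ hℓ t ht using h t (hℓ.trans ht)
  exact hev.exists

end LowerSets

/-! ### Transcendence bases from ranked families -/

section Parametric

variable {F K ι α : Type*} [Field F] [Field K] [Algebra F K] [LinearOrder α]

/-- The indices at which a family ranked by `rk` is transcendental over its predecessors. -/
def parametricSet (F : Type*) [Field F] [Algebra F K] (rk : ι → α) (v : ι → K) : Set ι :=
  {p | Transcendental (Algebra.adjoin F (v '' {q | rk q < rk p})) (v p)}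

theorem algebraicIndepOn_parametricSet_and_isAlgebraic {rk : ι → α}
    (hrk : Function.Injective rk) (v : ι → K) (s : Finset ι)
    (hs : ∀ p ∈ s, ∀ q, rk q < rk p → q ∈ s) :
    AlgebraicIndepOn F v (parametricSet F rk v ∩ s) ∧
      ∀ p ∈ s, IsAlgebraic (Algebra.adjoin F (v '' (parametricSet F rk v ∩ s))) (v p) := by
  classical
  induction s using Finset.induction_on_max_value rk with
  | empty =>
    refine ⟨?_, by simp⟩
    simp only [Finset.coe_empty, Set.inter_empty]
    exact algebraicIndependent_empty_type_iff.2 (algebraMap F K).injective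
  | insert a s ha hmax ih =>
    -- Since `a` has maximal rank and the finite set is closed under predecessors, "over the
    -- predecessors" means "over `s`".
    have hpred : {q | rk q < rk a} = (s : Set ι) := by
      ext q
      refine ⟨fun hq => ?_, fun hq => (hmax q hq).lt_of_ne fun h => ha (hrk h ▸ hq)⟩
      exact Finset.mem_of_mem_insert_of_ne (hs a (Finset.mem_insert_self _ _) q hq)
        fun h => lt_irrefl _ (h ▸ hq : rk a < rk a)
    obtain ⟨hind, halg⟩ := ih fun p hp q hq =>
      Finset.mem_of_mem_insert_of_ne (hs p (Finset.mem_insert_of_mem hp) q hq)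
        fun h => absurd (hmax p hp) (not_le.2 (h ▸ hq))
    have hle : Algebra.adjoin F (v '' (parametricSet F rk v ∩ s)) ≤ Algebra.adjoin F (v '' s) :=
      Algebra.adjoin_mono (Set.image_mono Set.inter_subset_right)
    by_cases hpar : a ∈ parametricSet F rk v
    · have hset : parametricSet F rk v ∩ (insert a s : Finset ι) =
          insert a (parametricSet F rk v ∩ s) := by
        rw [Finset.coe_insert, Set.inter_insert_of_mem hpar]
      have htr : Transcendental (Algebra.adjoin F (v '' s)) (v a) := by
        have h := hpar
        rw [parametricSet, Set.mem_ofPred_eq, hpred] at h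
        exact h
      rw [hset]
      refine ⟨hind.insert (htr.of_tower_top_of_subalgebra_le hle), fun p hp => ?_⟩
      rcases Finset.mem_insert.1 hp with rfl | hp
      · exact isAlgebraic_algebraMap (⟨v p, Algebra.subset_adjoin ⟨p, Set.mem_insert _ _, rfl⟩⟩ :
          Algebra.adjoin F (v '' insert p (parametricSet F rk v ∩ s)))
      · exact (halg p hp).tower_top_of_subalgebra_le
          (Algebra.adjoin_mono (Set.image_mono (Set.subset_insert _ _)))
    · have hset : parametricSet F rk v ∩ (insert a s : Finset ι) = parametricSet F rk v ∩ s := by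
        rw [Finset.coe_insert, Set.inter_insert_of_notMem hpar]
      have hal : IsAlgebraic (Algebra.adjoin F (v '' s)) (v a) := by
        have h := hpar
        rw [parametricSet, Set.mem_ofPred_eq, hpred, Transcendental, not_not] at h
        exact h
      rw [hset]
      refine ⟨hind, fun p hp => ?_⟩
      rcases Finset.mem_insert.1 hp with rfl | hp
      · refine hal.adjoin_of_forall_isAlgebraic ?_
        rintro _ ⟨⟨q, hq, rfl⟩, -⟩
        exact halg q hq
      · exact halg p hp

/-- If a subfamily of `v` indexed by `b ⊆ s` is algebraically independent, the transcendence degree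
of the field generated by `v '' s` is at least the size of `b`. -/
theorem natCast_ncard_le_trdeg_adjoin {ι : Type} {v : ι → K} {b s : Set ι} (hb : b.Finite)
    (hbs : b ⊆ s) (hind : AlgebraicIndepOn F v b) :
    (b.ncard : Cardinal) ≤ Algebra.trdeg F (IntermediateField.adjoin F (v '' s)) := by
  set E := IntermediateField.adjoin F (v '' s)
  let y : b → E := fun p => ⟨v p, IntermediateField.subset_adjoin F _ ⟨p, hbs p.2, rfl⟩⟩
  have hy : AlgebraicIndependent F y :=
    (AlgHom.algebraicIndependent_iff E.val Subtype.val_injective).1 hind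
  have h := hy.lift_cardinalMk_le_trdeg
  rwa [← Set.cast_ncard hb, Cardinal.lift_natCast, Cardinal.lift_uzero] at h

/-- If moreover `v '' s` is algebraic over the subfamily, equality holds. -/
theorem trdeg_adjoin_eq_ncard {ι : Type} {v : ι → K} {b s : Set ι} (hb : b.Finite)
    (hbs : b ⊆ s) (hind : AlgebraicIndepOn F v b)
    (halg : ∀ p ∈ s, IsAlgebraic (Algebra.adjoin F (v '' b)) (v p)) :
    Algebra.trdeg F (IntermediateField.adjoin F (v '' s)) = b.ncard := by
  set E := IntermediateField.adjoin F (v '' s)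
  let y : b → E := fun p => ⟨v p, IntermediateField.subset_adjoin F _ ⟨p, hbs p.2, rfl⟩⟩
  have hy : AlgebraicIndependent F y :=
    (AlgHom.algebraicIndependent_iff E.val Subtype.val_injective).1 hind
  have hmap : (Algebra.adjoin F (Set.range y)).map E.val = Algebra.adjoin F (v '' b) := by
    rw [AlgHom.map_adjoin, ← Set.range_comp, Set.image_eq_range]
    rfl
  have hbasis : IsTranscendenceBasis F y := by
    refine hy.isTranscendenceBasis_iff_isAlgebraic.2 ⟨fun a => ?_⟩
    have ha : IsAlgebraic (Algebra.adjoin F (v '' b)) (a : K) := by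
      have h1 : IsAlgebraic (IntermediateField.adjoin F (v '' s)) (a : K) :=
        isAlgebraic_algebraMap a
      refine (IntermediateField.isAlgebraic_adjoin_iff.1 h1).adjoin_of_forall_isAlgebraic ?_
      rintro _ ⟨⟨p, hp, rfl⟩, -⟩
      exact halg p hp
    rw [← hmap] at ha
    exact ha.of_ringHom_of_comp_eq
      ((Algebra.adjoin F (Set.range y)).equivMapOfInjective E.val Subtype.val_injective) E.val
      (AlgEquiv.surjective _) Subtype.val_injective rfl
  have h := hbasis.lift_cardinalMk_eq_trdeg
  rw [← Set.cast_ncard hb, Cardinal.lift_natCast, Cardinal.lift_uzero] at h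
  exact h.symm

end Parametric

/-! ### Derivations and algebraic elements -/

section Derivations

variable {K : Type*} [Field K]

/-- A derivation of `K` which maps the subfield `L` into the larger subfield `M` maps the elements
of `M` algebraic over `L` into `M`. -/
theorem derivation_mem_of_isAlgebraic [CharZero K] {F : Type*} [Field F] [Algebra F K]
    (D : Derivation ℤ K K) {L M : IntermediateField F K} (hLM : L ≤ M)
    (hD : ∀ a ∈ L, D a ∈ M) {a : K} (haM : a ∈ M) (ha : IsAlgebraic L a) : D a ∈ M := by
  have key : ∀ p : Polynomial L,
      D (Polynomial.aeval a p) - Polynomial.aeval a (Polynomial.derivative p) * D a ∈ M := by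
    intro p
    induction p using Polynomial.induction_on' with
    | add p q hp hq =>
      have := M.add_mem hp hq
      simp only [map_add]
      convert! this using 1
      ring
    | monomial k c =>
      have : D (c : K) * a ^ k ∈ M := M.mul_mem (hD _ c.2) (pow_mem haM k)
      convert! this using 1
      rw [Polynomial.derivative_monomial, Polynomial.aeval_monomial, Polynomial.aeval_monomial,
        D.leibniz, D.leibniz_pow]
      simp only [smul_eq_mul, nsmul_eq_mul, map_mul, map_natCast]
      change (c : K) * _ + _ * D (c : K) - (c : K) * _ * _ * _ = _
      ring
  have hmem := key (minpoly L a)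
  -- Separability in characteristic zero lets the differentiated minimal equation be solved for `D
  -- a`.
  have hne : Polynomial.aeval a (Polynomial.derivative (minpoly L a)) ≠ 0 :=
    (minpoly.irreducible ha.isIntegral).separable.aeval_derivative_ne_zero (minpoly.aeval L a)
  have haeval : ∀ p : Polynomial L, Polynomial.aeval a p ∈ M := by
    intro p
    rw [Polynomial.aeval_eq_sum_range]
    exact M.sum_mem fun i _ => M.mul_mem (hLM (p.coeff i).2) (pow_mem haM i)
  rw [minpoly.aeval, map_zero, zero_sub, neg_mem_iff] at hmem
  have := M.mul_mem (M.inv_mem (haeval (Polynomial.derivative (minpoly L a)))) hmem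
  rwa [inv_mul_cancel_left₀ hne] at this

/-- A derivation maps the field generated by `s` into `M` if it does so for the generators and for
the ground field. -/
theorem derivation_adjoin_mem {F : Type*} [Field F] [Algebra F K] (D : Derivation ℤ K K)
    {s : Set K} {M : IntermediateField F K} (hs : s ⊆ M) (hDs : ∀ a ∈ s, D a ∈ M)
    (hDF : ∀ a : F, D (algebraMap F K a) ∈ M) {a : K} (ha : a ∈ IntermediateField.adjoin F s) :
    D a ∈ M := by
  have hle : IntermediateField.adjoin F s ≤ M := IntermediateField.adjoin_le_iff.2 hs
  induction ha using IntermediateField.adjoin_induction with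
  | mem x hx => exact hDs x hx
  | algebraMap x => exact hDF x
  | add x y hx hy ihx ihy => rw [map_add]; exact M.add_mem ihx ihy
  | inv x hx ih =>
    rw [D.leibniz_inv]
    exact M.mul_mem (M.neg_mem (pow_mem (M.inv_mem (hle hx)) 2)) ih
  | mul x y hx hy ihx ihy =>
    rw [D.leibniz]
    exact M.add_mem (M.mul_mem (hle hx) ihy) (M.mul_mem (hle hy) ihx)

theorem mul_prod_ofFn_pow {M : Type*} [Monoid M] {m : ℕ} (f : Fin m → M)
    (hf : ∀ i j, Commute (f i) (f j)) (e : Fin m → ℕ) (k : Fin m) :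
    f k * (List.ofFn fun i => f i ^ e i).prod =
      (List.ofFn fun i => f i ^ (e + Pi.single k 1 : Fin m → ℕ) i).prod := by
  induction m with
  | zero => exact k.elim0
  | succ m ih =>
    simp only [List.ofFn_succ, List.prod_cons]
    cases k using Fin.cases with
    | zero =>
      simp [pow_succ', mul_assoc, Fin.succ_ne_zero]
    | succ k =>
      rw [← mul_assoc, ((hf k.succ 0).pow_right _).eq, mul_assoc,
        ih (fun i => f i.succ) (fun i j => hf _ _) (fun i => e i.succ) k]
      simp [Pi.single_apply, (Fin.succ_ne_zero k).symm]

theorem derivOp_add_single {m : ℕ} {δ : Fin m → Derivation ℤ K K}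
    (hcomm : ∀ i j a, δ i (δ j a) = δ j (δ i a)) (e : Fin m → ℕ) (k : Fin m) (a : K) :
    δ k (derivOp δ e a) = derivOp δ (e + Pi.single k 1) a := by
  have h := mul_prod_ofFn_pow (fun k => ((δ k : K →ₗ[ℤ] K) : Module.End ℤ K))
    (fun i j => LinearMap.ext fun a => hcomm i j a) e k
  exact LinearMap.congr_fun h a

end Derivations

/-! ### The orderly ranking -/

section Ranking

variable {m n : ℕ}

/-- An orderly ranking of the derivatives of `n` indeterminates. -/
def rank (p : Fin n × (Fin m → ℕ)) : ℕ ×ₗ (Fin n ×ₗ Lex (Fin m → ℕ)) :=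
  toLex (∑ k, p.2 k, toLex (p.1, toLex p.2))

/-- The index of the derivative with respect to `δ k`. -/
def shift (k : Fin m) (p : Fin n × (Fin m → ℕ)) : Fin n × (Fin m → ℕ) :=
  (p.1, p.2 + Pi.single k 1)

theorem rank_injective : Function.Injective (rank (m := m) (n := n)) := by
  rintro ⟨i, e⟩ ⟨j, f⟩ h
  simp only [rank, EmbeddingLike.apply_eq_iff_eq, Prod.mk.injEq] at h
  simp [h.2]

theorem sum_shift (k : Fin m) (p : Fin n × (Fin m → ℕ)) :
    ∑ j, (shift k p).2 j = ∑ j, p.2 j + 1 := by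
  simp [shift, Finset.sum_add_distrib]

theorem sum_le_of_rank_lt {p q : Fin n × (Fin m → ℕ)} (h : rank q < rank p) :
    ∑ k, q.2 k ≤ ∑ k, p.2 k := by
  rcases Prod.Lex.lt_iff.1 h with h | h
  · exact h.le
  · exact h.1.le

theorem rank_lt_rank_shift (k : Fin m) (p : Fin n × (Fin m → ℕ)) : rank p < rank (shift k p) :=
  Prod.Lex.lt_iff.2 (Or.inl (by
    change ∑ j, p.2 j < ∑ j, (shift k p).2 j
    rw [sum_shift]
    exact Nat.lt_succ_self _))

theorem rank_shift_lt_rank_shift (k : Fin m) {p q : Fin n × (Fin m → ℕ)} (h : rank q < rank p) :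
    rank (shift k q) < rank (shift k p) := by
  have hq := sum_shift k q
  have hp := sum_shift k p
  rcases Prod.Lex.lt_iff.1 h with h | ⟨h, h'⟩
  · refine Prod.Lex.lt_iff.2 (Or.inl ?_)
    change ∑ j, q.2 j < ∑ j, p.2 j at h
    change ∑ j, (shift k q).2 j < ∑ j, (shift k p).2 j
    omega
  · refine Prod.Lex.lt_iff.2 (Or.inr ⟨?_, ?_⟩)
    · change ∑ j, q.2 j = ∑ j, p.2 j at h
      change ∑ j, (shift k q).2 j = ∑ j, (shift k p).2 j
      omega
    · rcases Prod.Lex.lt_iff.1 h' with h' | ⟨h', h''⟩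
      · exact Prod.Lex.lt_iff.2 (Or.inl h')
      · refine Prod.Lex.lt_iff.2 (Or.inr ⟨h', ?_⟩)
        change toLex q.2 < toLex p.2 at h''
        change toLex q.2 + toLex (Pi.single k 1) < toLex p.2 + toLex (Pi.single k 1)
        exact add_lt_add_left h'' _

theorem add_mem_of_add_single_mem {S : Set (Fin m → ℕ)}
    (hS : ∀ e ∈ S, ∀ k, e + Pi.single k 1 ∈ S) (d : Fin m → ℕ) :
    ∀ e ∈ S, e + d ∈ S := by
  let T : AddSubmonoid (Fin m → ℕ) :=
    { carrier := {d | ∀ e ∈ S, e + d ∈ S}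
      zero_mem' := fun e he => by simpa using he
      add_mem' := fun {a b} ha hb e he => by
        rw [← add_assoc]
        exact hb _ (ha e he) }
  change d ∈ T
  rw [← Finset.univ_sum_single d]
  refine T.sum_mem fun k _ => ?_
  have hk : Pi.single k 1 ∈ T := fun e he => hS e he k
  have := T.nsmul_mem hk (d k)
  rwa [← Pi.single_smul, smul_eq_mul, mul_one] at this

end Ranking

/-! ### Parametric derivatives of a point; generic points -/

section Points

variable {K : Type*} [Field K] {m n : ℕ} (δ : Fin m → Derivation ℤ K K) (F : Subfield K)

/-- The family of all derivatives of the coordinates of `c`. -/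
noncomputable def jet (c : Fin n → K) (p : Fin n × (Fin m → ℕ)) : K :=
  derivOp δ p.2 (c p.1)

theorem prolongationField_eq (t : ℕ) (c : Fin n → K) :
    prolongationField δ F t c =
      IntermediateField.adjoin F (jet δ c '' indicesUpTo m n t) := by
  rw [prolongationField]
  congr 1
  ext a
  constructor
  · rintro ⟨i, e, he, rfl⟩
    exact ⟨(i, e), he, rfl⟩
  · rintro ⟨⟨i, e⟩, he, rfl⟩
    exact ⟨i, e, he, rfl⟩

theorem finite_parametricSet_inter (c : Fin n → K) (t : ℕ) :
    (parametricSet F rank (jet δ c) ∩ indicesUpTo m n t).Finite :=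
  (finite_indicesUpTo m n t).inter_of_right _

theorem parametricSet_jet_spec (c : Fin n → K) (t : ℕ) :
    AlgebraicIndepOn F (jet δ c) (parametricSet F rank (jet δ c) ∩ indicesUpTo m n t) ∧
      ∀ p ∈ indicesUpTo m n t, IsAlgebraic (Algebra.adjoin F (jet δ c ''
        (parametricSet F rank (jet δ c) ∩ indicesUpTo m n t))) (jet δ c p) := by
  have h := algebraicIndepOn_parametricSet_and_isAlgebraic (F := F) rank_injective (jet δ c)
    (finite_indicesUpTo m n t).toFinset (by
      intro p hp q hq
      rw [Set.Finite.mem_toFinset] at hp ⊢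
      exact (sum_le_of_rank_lt hq).trans hp)
  rw [Set.Finite.coe_toFinset] at h
  simpa only [Set.Finite.mem_toFinset] using h

theorem prolongationTrdeg_eq_ncard (c : Fin n → K) (t : ℕ) :
    prolongationTrdeg δ F t c =
      (parametricSet F rank (jet δ c) ∩ indicesUpTo m n t).ncard := by
  rw [prolongationTrdeg, prolongationField_eq]
  exact trdeg_adjoin_eq_ncard (finite_parametricSet_inter δ F c t) Set.inter_subset_right
    (parametricSet_jet_spec δ F c t).1 (parametricSet_jet_spec δ F c t).2

variable {δ F}

/-- `δ k` sends predecessors of `p` to predecessors of `shift k p`, and `p` itself precedes `shift k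
p`. Hence `derivation_mem_of_isAlgebraic` puts the shifted derivative in the field generated by its
predecessors. -/
theorem shift_notMem_parametricSet [CharZero K]
    (hcomm : ∀ i j a, δ i (δ j a) = δ j (δ i a)) (hF : ∀ i, ∀ a ∈ F, δ i a ∈ F)
    (c : Fin n → K) {p : Fin n × (Fin m → ℕ)} (hp : p ∉ parametricSet F rank (jet δ c))
    (k : Fin m) : shift k p ∉ parametricSet F rank (jet δ c) := by
  have hjet : ∀ q, δ k (jet δ c q) = jet δ c (shift k q) := fun q =>
    derivOp_add_single hcomm q.2 k (c q.1)
  rw [parametricSet, Set.mem_ofPred_eq, Transcendental, not_not] at hp ⊢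
  rw [← IntermediateField.isAlgebraic_adjoin_iff] at hp ⊢
  set L := IntermediateField.adjoin F (jet δ c '' {q | rank q < rank p})
  set M := IntermediateField.adjoin F (jet δ c '' {q | rank q < rank (shift k p)})
  have hmem : ∀ q, rank q < rank (shift k p) → jet δ c q ∈ M := fun q hq =>
    IntermediateField.subset_adjoin F _ ⟨q, hq, rfl⟩
  have hsub : jet δ c '' {q | rank q < rank p} ⊆ M := by
    rintro _ ⟨q, hq, rfl⟩
    exact hmem q (lt_trans hq (rank_lt_rank_shift k p))
  have hD : δ k (jet δ c p) ∈ M := by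
    refine derivation_mem_of_isAlgebraic (δ k) (IntermediateField.adjoin_le_iff.2 hsub)
      (fun a ha => derivation_adjoin_mem (δ k) hsub ?_ (fun a => ?_) ha)
      (hmem p (rank_lt_rank_shift k p)) hp
    · rintro _ ⟨q, hq, rfl⟩
      rw [hjet]
      exact hmem _ (rank_shift_lt_rank_shift k hq)
    · exact M.algebraMap_mem ⟨δ k a, hF k a a.2⟩
  rw [hjet] at hD
  exact isAlgebraic_algebraMap (⟨_, hD⟩ : M)

/-- The parametric derivatives of each coordinate form a set closed downwards. -/
noncomputable def parametricLowerSet [CharZero K]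
    (hcomm : ∀ i j a, δ i (δ j a) = δ j (δ i a)) (hF : ∀ i, ∀ a ∈ F, δ i a ∈ F)
    (c : Fin n → K) (i : Fin n) : LowerSet (Fin m → ℕ) where
  carrier := {e | (i, e) ∈ parametricSet F rank (jet δ c)}
  lower' := by
    intro e e' hle he
    by_contra hnot
    have := add_mem_of_add_single_mem (S := {e | (i, e) ∉ parametricSet F rank (jet δ c)})
      (fun e he k => shift_notMem_parametricSet hcomm hF c he k) (e - e') e' hnot
    rw [add_tsub_cancel_of_le hle] at this
    exact this he

theorem IsGenericPoint.evalAt_eq_zero {X : Set (Fin n → K)} {x x' : Fin n → K}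
    (hx : IsGenericPoint δ F X x) (hx' : IsGenericPoint δ F X x') {f : DeltaPoly F m n}
    (hf : evalAt δ F x f = 0) : evalAt δ F x' f = 0 := by
  have hmem : x' ∈ kolchinLocus δ F x := hx.2 ▸ hx'.1
  have hzero := Set.mem_sInter.1 hmem (zeroSet δ F {f})
    ⟨⟨{f}, rfl⟩, fun g hg => by rw [Set.mem_singleton_iff.1 hg]; exact hf⟩
  exact hzero f (Set.mem_singleton f)

/-- Generic points satisfy the same `Δ`-polynomials, so an independent set of derivatives at `x`
stays independent at `x'`. -/
theorem IsGenericPoint.prolongationTrdeg_le {X : Set (Fin n → K)} {x x' : Fin n → K}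
    (hx : IsGenericPoint δ F X x) (hx' : IsGenericPoint δ F X x') (t : ℕ) :
    prolongationTrdeg δ F t x ≤ prolongationTrdeg δ F t x' := by
  rw [prolongationTrdeg_eq_ncard, prolongationTrdeg, prolongationField_eq]
  refine natCast_ncard_le_trdeg_adjoin (finite_parametricSet_inter δ F x t)
    Set.inter_subset_right ?_
  have hind := (parametricSet_jet_spec δ F x t).1
  rw [AlgebraicIndepOn, algebraicIndependent_iff] at hind ⊢
  intro f hf
  refine hind f ?_
  have h : evalAt δ F x' (MvPolynomial.rename Subtype.val f) = 0 := by
    rw [evalAt, MvPolynomial.aeval_rename]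
    exact hf
  have h' := hx'.evalAt_eq_zero hx h
  rw [evalAt, MvPolynomial.aeval_rename] at h'
  exact h'

/-- The transcendence degrees of the prolongations agree at all generic points. -/
theorem IsGenericPoint.prolongationTrdeg_eq {X : Set (Fin n → K)} {x x' : Fin n → K}
    (hx : IsGenericPoint δ F X x) (hx' : IsGenericPoint δ F X x') (t : ℕ) :
    prolongationTrdeg δ F t x = prolongationTrdeg δ F t x' :=
  le_antisymm (hx.prolongationTrdeg_le hx' t) (hx'.prolongationTrdeg_le hx t)

end Points

end DeltaGeometry

theorem proposition5p5 {K : Type*} [Field K] [CharZero K] {m n : ℕ}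
    (δ : Fin m → Derivation ℤ K K)
    (hcomm : ∀ i j a, δ i (δ j a) = δ j (δ i a))
    (F : Subfield K) (hF : ∀ i, ∀ a ∈ F, δ i a ∈ F)
    (X : Set (Fin n → K)) (hX : DeltaGeometry.IsIrredDeltaVariety δ F X) :
    ∃ ℓ : ℕ, ∀ Y : Set (Fin n → K),
      DeltaGeometry.IsIrredDeltaVariety δ F Y → DeltaGeometry.IsCodimOne δ F X Y →
      ∀ x y : Fin n → K,
        DeltaGeometry.IsGenericPoint δ F X x → DeltaGeometry.IsGenericPoint δ F Y y →
        ∀ t ≥ ℓ, DeltaGeometry.prolongationTrdeg δ F t y + 1 =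
          DeltaGeometry.prolongationTrdeg δ F t x := by
  open DeltaGeometry in
  by_cases hgen : ∃ x₀, IsGenericPoint δ F X x₀
  · obtain ⟨x₀, hx₀⟩ := hgen
    obtain ⟨ℓ, hℓ⟩ := exists_uniform_bound (m := m) (n := n)
      fun t => (parametricSet F rank (jet δ x₀) ∩ indicesUpTo m n t).ncard
    refine ⟨ℓ, fun Y _ hY x y hx hy t ht => ?_⟩
    obtain ⟨-, x₁, y₁, hx₁, hy₁, t₀, h⟩ := hY
    have hcount := hℓ (parametricLowerSet hcomm hF y) ⟨t₀, fun s hs => by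
      have hs := h s hs
      rw [hy₁.prolongationTrdeg_eq hy, hx₁.prolongationTrdeg_eq hx₀, prolongationTrdeg_eq_ncard,
        prolongationTrdeg_eq_ncard] at hs
      exact_mod_cast hs⟩ t ht
    rw [hx.prolongationTrdeg_eq hx₀, prolongationTrdeg_eq_ncard, prolongationTrdeg_eq_ncard]
    exact_mod_cast hcount
  -- Without a generic point of `X` the claim is vacuous, so any bound will do.
  · exact ⟨0, fun Y _ _ x y hx => absurd ⟨x, hx⟩ hgen⟩
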